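/- Setting. Let $\Omega$ be a locally compact Hausdorff space with a $\sigma$-finite positive Borel measure $\mu$, and let $(H_s)_{s\in\Omega}$ be complex Hilbert spaces with a measurable field structure, i.e. a set $\mathcal F$ of sections $x=(x(s))_{s}$, $x(s)\in H_s$, such that: (1) $s\mapsto\langle x(s),y(s)\rangle_s$ is $\mu$-measurable for all $x,y\in\mathcal F$; (2) every section $z$ for which $s\mapsto\langle x(s),z(s)\rangle_s$ is $\mu$-measurable for all $x\in\mathcal F$ belongs to $\mathcal F$; (3) there is a sequence $(\xi_i)$ in $\mathcal F$ such that $\{\xi_i(s)\}_i$ is dense in $H_s$ for every $s$. The direct integral $\int_\Omega^\oplus H_s\,d\mu(s)$ is the Hilbert space of all $x\in\mathcal F$ with $\int_\Omega\|x(s)\|_s^2\,d\mu(s)<\infty$, modulo $\mu$-a.e. equality, with inner product $\int_\Omega\langle x(s),y(s)\rangle_s\,d\mu(s)$. A family of bounded operators $R(s)\in\mathcal B(H_s)$ is a *bounded measurable field* if $s\mapsto\langle R(s)x(s),y(s)\rangle_s$ is $\mu$-measurable for all $x,y\in\mathcal F$ and $s\mapsto\|R(s)\|$ is essentially bounded.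 A family of closed operators $A(s):D(A(s))\subset H_s\to H_s$, $s\in\Omega$, is a *measurable field of closed operators* if there is a fixed $\nu\in\mathbb C$ such that $\nu\in\rho(A(s))$ for a.e. $s$ and the resolvents $R(\nu,A(s))$, adjusted on a null set, form a bounded measurable field. Its direct integral $\int_\Omega^\oplus A(s)\,d\mu(s)$ is the operator on $\int_\Omega^\oplus H_s\,d\mu(s)$ whose domain consists of all $x$ such that $x(s)\in D(A(s))$ for a.e. $s$ and $A(\cdot)x(\cdot)\in\int_\Omega^\oplus H_s\,d\mu(s)$, and which maps $x$ to $A(\cdot)x(\cdot)$. Writing $\int_\Omega^\oplus A(s)\,d\mu(s)$ includes the assertion that $(A(s))$ is a measurable field of closed operators. Theorem. For each $s\in\Omega$ let $T^{(\cdot)}(s):[0,\infty)\to\mathcal B(H_s)$ be a $C_0$-semigroup, and suppose that for each $t\ge0$ the direct integral $$T(t):=\int_\Omega^\oplus T^t(s)\,d\mu(s)$$ exists as a bounded operator on $\int_\Omega^\oplus H_s\,d\mu(s)$. Then $T$ is a $C_0$-semigroup if and only if there exist $M\ge1$ and $\omega\in\mathbb R$ such that $$\|T^t(s)\|_{\mathcal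 B(H_s)}\le Me^{\omega t}\quad\text{for a.e. } s\in\Omega \text{ and all } t>0.\qquad(*)$$ In this case, for all $M\ge1$ and $\omega\in\mathbb R$ satisfying $(*)$, one has $\|T(t)\|\le Me^{\omega t}$ for all $t\ge0$; moreover, the generator of $T$ is $$\int_\Omega^\oplus A(s)\,d\mu(s),$$ where $(A(s))_{s\in\Omega}$ is any family of closed operators such that $A(s)$ is the generator of $T^{(\cdot)}(s)$ for a.e. $s\in\Omega$ (in particular, such a family is a measurable field of closed operators). -/

import Mathlib

open MeasureTheory Filter Topology
open scoped NNReal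

noncomputable section

/-! ### `C₀`-semigroups and their generators -/

section Semigroups

variable {X : Type*} [NormedAddCommGroup X] [NormedSpace ℂ X]

/-- `T : [0, ∞) → B(X)` is a `C₀`-semigroup (strongly continuous one-parameter semigroup). -/
structure IsC0Semigroup (T : ℝ≥0 → X →L[ℂ] X) : Prop where
  map_zero : T 0 = ContinuousLinearMap.id ℂ X
  map_add : ∀ t u : ℝ≥0, T (t + u) = (T t).comp (T u)
  continuous_orbit : ∀ x : X, Continuous fun t : ℝ≥0 => T t x

/-- The graph of the infinitesimal generator: all `(x, y)` with
`y = lim_{t ↓ 0} (T(t) x - x) / t`. -/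
def generatorGraph (T : ℝ≥0 → X →L[ℂ] X) : Submodule ℂ (X × X) where
  carrier := {p | Tendsto (fun t : ℝ≥0 => ((t : ℝ) : ℂ)⁻¹ • (T t p.1 - p.1)) (𝓝[>] 0) (𝓝 p.2)}
  zero_mem' := by simp
  add_mem' := by
    intro p q hp hq
    refine (hp.add hq).congr fun t => ?_
    simp only [Prod.fst_add, map_add, ← smul_add]
    congr 1
    abel
  smul_mem' := by
    intro c p hp
    refine (hp.const_smul c).congr fun t => ?_
    simp only [Prod.smul_fst, map_smul]
    rw [smul_comm, smul_sub]

/-- The infinitesimal generator `A` of `T`: its domain is the set of all `x` for which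
`lim_{t ↓ 0} (T(t) x - x) / t` exists, and `A x` is this limit. -/
def generator (T : ℝ≥0 → X →L[ℂ] X) : X →ₗ.[ℂ] X :=
  (generatorGraph T).toLinearPMap

theorem mem_graph_generator (T : ℝ≥0 → X →L[ℂ] X) (x y : X) :
    (x, y) ∈ (generator T).graph ↔
      Tendsto (fun t : ℝ≥0 => ((t : ℝ) : ℂ)⁻¹ • (T t x - x)) (𝓝[>] 0) (𝓝 y) := by
  rw [generator, Submodule.toLinearPMap_graph_eq]
  · rfl
  · rintro ⟨a, b⟩ hab ha
    have ha' : a = 0 := ha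
    subst ha'
    have h : Tendsto (fun t : ℝ≥0 => ((t : ℝ) : ℂ)⁻¹ • (T t (0 : X) - 0)) (𝓝[>] 0) (𝓝 b) := hab
    simp only [map_zero, sub_zero, smul_zero] at h
    exact tendsto_nhds_unique h tendsto_const_nhds

/-- `R` is the resolvent `R(z, A) = (z - A)⁻¹`, an everywhere defined bounded operator; thus `z`
lies in the resolvent set of `A` if and only if such an `R` exists (and then it is unique). -/
def IsResolventAt (A : X →ₗ.[ℂ] X) (z : ℂ) (R : X →L[ℂ] X) : Prop :=
  (∀ y : X, ∃ h : R y ∈ A.domain, z • R y - A ⟨R y, h⟩ = y) ∧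
    ∀ x : A.domain, R (z • (x : X) - A x) = x

/-- A bounded operator, viewed as an unbounded operator with domain the whole space. -/
def ContinuousLinearMap.toFullPMap (T : X →L[ℂ] X) : X →ₗ.[ℂ] X :=
  (T : X →ₗ[ℂ] X).toPMap ⊤

end Semigroups

/-! ### Measurable fields of Hilbert spaces and their direct integral -/

section Fields

variable {Ω : Type*} [MeasurableSpace Ω] {μ : Measure Ω}
  {H : Ω → Type*} [∀ s, NormedAddCommGroup (H s)] [∀ s, InnerProductSpace ℂ (H s)]

/-- A measurable field of Hilbert spaces: a choice of measurable sections of the bundle with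
fibres `H s`. A `ℂ`-valued function is `μ`-measurable if it is measurable with respect to the
`μ`-completion of the σ-algebra, which is `AEMeasurable`. -/
structure MeasurableHilbertField (μ : Measure Ω) (H : Ω → Type*)
    [∀ s, NormedAddCommGroup (H s)] [∀ s, InnerProductSpace ℂ (H s)] where
  /-- the measurable sections -/
  sections : Set (∀ s, H s)
  aemeasurable_inner : ∀ x ∈ sections, ∀ y ∈ sections,
    AEMeasurable (fun s => inner ℂ (x s) (y s)) μ
  mem_of_aemeasurable_inner : ∀ z : ∀ s, H s,
    (∀ x ∈ sections, AEMeasurable (fun s => inner ℂ (x s) (z s)) μ) → z ∈ sections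
  exists_fundamental : ∃ ξ : ℕ → ∀ s, H s,
    (∀ i, ξ i ∈ sections) ∧ ∀ s, Dense (Set.range fun i => ξ i s)

variable (𝓕 : MeasurableHilbertField μ H)

namespace MeasurableHilbertField

theorem add_mem {x y : ∀ s, H s} (hx : x ∈ 𝓕.sections) (hy : y ∈ 𝓕.sections) :
    x + y ∈ 𝓕.sections := by
  refine 𝓕.mem_of_aemeasurable_inner _ fun z hz => ?_
  simp only [Pi.add_apply, inner_add_right]
  exact (𝓕.aemeasurable_inner z hz x hx).add (𝓕.aemeasurable_inner z hz y hy)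

theorem smul_mem (c : ℂ) {x : ∀ s, H s} (hx : x ∈ 𝓕.sections) : c • x ∈ 𝓕.sections := by
  refine 𝓕.mem_of_aemeasurable_inner _ fun z hz => ?_
  simp only [Pi.smul_apply, inner_smul_right]
  exact (𝓕.aemeasurable_inner z hz x hx).const_mul c

theorem aemeasurable_norm {x : ∀ s, H s} (hx : x ∈ 𝓕.sections) :
    AEMeasurable (fun s => ‖x s‖) μ := by
  have h := Complex.measurable_re.comp_aemeasurable (𝓕.aemeasurable_inner x hx x hx)
  refine h.sqrt.congr (Eventually.of_forall fun s => ?_)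
  exact (norm_eq_sqrt_re_inner (𝕜 := ℂ) (x s)).symm

/-- The square-integrable measurable sections. -/
def squareIntegrable : Submodule ℂ (∀ s, H s) where
  carrier := {x | x ∈ 𝓕.sections ∧ Integrable (fun s => ‖x s‖ ^ 2) μ}
  zero_mem' := by
    refine ⟨𝓕.mem_of_aemeasurable_inner _ fun z _ => ?_, ?_⟩
    · simp
    · simp
  add_mem' := by
    rintro x y ⟨hx, hx2⟩ ⟨hy, hy2⟩
    refine ⟨𝓕.add_mem hx hy, ?_⟩
    refine ((hx2.add hy2).const_mul 2).mono'
      (((𝓕.aemeasurable_norm (𝓕.add_mem hx hy)).pow_const 2).aestronglyMeasurable)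
      (Eventually.of_forall fun s => ?_)
    simp only [Pi.add_apply, Real.norm_eq_abs, abs_pow, abs_norm]
    nlinarith [norm_add_le (x s) (y s), norm_nonneg (x s + y s), sq_nonneg (‖x s‖ - ‖y s‖)]
  smul_mem' := by
    rintro c x ⟨hx, hx2⟩
    refine ⟨𝓕.smul_mem c hx, ?_⟩
    simp only [Pi.smul_apply, norm_smul, mul_pow]
    exact hx2.const_mul _

/-- The square-integrable measurable sections that vanish `μ`-a.e. -/
def nullSections : Submodule ℂ 𝓕.squareIntegrable where
  carrier := {x | ∀ᵐ s ∂μ, (x : ∀ s, H s) s = 0}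
  zero_mem' := by simp
  add_mem' := by
    intro x y hx hy
    change ∀ᵐ s ∂μ, (x : ∀ s, H s) s + (y : ∀ s, H s) s = 0
    filter_upwards [hx, hy] with s h1 h2
    rw [h1, h2, add_zero]
  smul_mem' := by
    intro c x hx
    change ∀ᵐ s ∂μ, c • (x : ∀ s, H s) s = 0
    filter_upwards [hx] with s h1
    rw [h1, smul_zero]

theorem integrable_inner (x y : 𝓕.squareIntegrable) :
    Integrable (fun s => inner ℂ ((x : ∀ s, H s) s) ((y : ∀ s, H s) s)) μ := by
  refine (x.2.2.add y.2.2).mono'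
    ((𝓕.aemeasurable_inner _ x.2.1 _ y.2.1).aestronglyMeasurable)
    (Eventually.of_forall fun s => ?_)
  refine (norm_inner_le_norm _ _).trans ?_
  simp only [Pi.add_apply]
  nlinarith [sq_nonneg (‖(x : ∀ s, H s) s‖ - ‖(y : ∀ s, H s) s‖),
    sq_nonneg ‖(x : ∀ s, H s) s‖, sq_nonneg ‖(y : ∀ s, H s) s‖]

end MeasurableHilbertField

/-- The direct integral `∫^⊕ H_s dμ(s)`: square-integrable measurable sections modulo those that
vanish `μ`-a.e. -/
def DirectIntegral : Type _ := 𝓕.squareIntegrable ⧸ 𝓕.nullSections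

namespace DirectIntegral

variable {𝓕}

instance : AddCommGroup (DirectIntegral 𝓕) :=
  inferInstanceAs (AddCommGroup (𝓕.squareIntegrable ⧸ 𝓕.nullSections))

instance : Module ℂ (DirectIntegral 𝓕) :=
  inferInstanceAs (Module ℂ (𝓕.squareIntegrable ⧸ 𝓕.nullSections))

/-- The class of a square-integrable measurable section. -/
def mk (x : 𝓕.squareIntegrable) : DirectIntegral 𝓕 := Submodule.Quotient.mk x

/-- A chosen representative of an element of the direct integral. -/
def repr (x : DirectIntegral 𝓕) : 𝓕.squareIntegrable := Quotient.out x

/-- The value at `s` of the chosen representative; it is determined by `x` for a.e. `s` only. -/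
instance : CoeFun (DirectIntegral 𝓕) (fun _ => ∀ s, H s) := ⟨fun x => (x.repr : ∀ s, H s)⟩

theorem mk_repr (x : DirectIntegral 𝓕) : mk x.repr = x := Quotient.out_eq x

theorem mk_eq_mk {x y : 𝓕.squareIntegrable} :
    mk x = mk y ↔ ∀ᵐ s ∂μ, (x : ∀ s, H s) s = (y : ∀ s, H s) s := by
  refine (Submodule.Quotient.eq 𝓕.nullSections).trans ?_
  change (∀ᵐ s ∂μ, (x : ∀ s, H s) s - (y : ∀ s, H s) s = 0) ↔ _
  simp only [sub_eq_zero]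

theorem coe_mk (x : 𝓕.squareIntegrable) : ∀ᵐ s ∂μ, mk x s = (x : ∀ s, H s) s :=
  mk_eq_mk.1 (mk_repr (mk x))

theorem ext_ae {x y : DirectIntegral 𝓕} (h : ∀ᵐ s ∂μ, x s = y s) : x = y := by
  rw [← mk_repr x, ← mk_repr y]
  exact mk_eq_mk.2 h

theorem coe_zero : ∀ᵐ s ∂μ, (0 : DirectIntegral 𝓕) s = 0 :=
  coe_mk (0 : 𝓕.squareIntegrable)

theorem coe_add (x y : DirectIntegral 𝓕) : ∀ᵐ s ∂μ, (x + y) s = x s + y s := by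
  have h : x + y = mk (x.repr + y.repr) := by
    conv_lhs => rw [← mk_repr x, ← mk_repr y]
    rfl
  rw [h]
  exact coe_mk (x.repr + y.repr)

theorem coe_smul (c : ℂ) (x : DirectIntegral 𝓕) : ∀ᵐ s ∂μ, (c • x) s = c • x s := by
  have h : c • x = mk (c • x.repr) := by
    conv_lhs => rw [← mk_repr x]
    rfl
  rw [h]
  exact coe_mk (c • x.repr)

/-- The inner product `⟨x, y⟩ = ∫ ⟨x(s), y(s)⟩_s dμ(s)`. -/
@[reducible] def innerCore : InnerProductSpace.Core ℂ (DirectIntegral 𝓕) where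
  inner x y := ∫ s, inner ℂ (x s) (y s) ∂μ
  conj_inner_symm x y := by
    rw [← integral_conj]
    exact integral_congr_ae (Eventually.of_forall fun s => inner_conj_symm _ _)
  re_inner_nonneg x := by
    have h := integral_re (𝓕.integrable_inner x.repr x.repr)
    change 0 ≤ RCLike.re (∫ s, inner ℂ (x s) (x s) ∂μ)
    rw [← h]
    exact integral_nonneg fun s => inner_self_nonneg
  add_left x y z := by
    rw [← integral_add (𝓕.integrable_inner x.repr z.repr) (𝓕.integrable_inner y.repr z.repr)]
    refine integral_congr_ae ?_
    filter_upwards [coe_add x y] with s hs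
    rw [hs, inner_add_left]
  smul_left x y c := by
    rw [← integral_const_mul]
    refine integral_congr_ae ?_
    filter_upwards [coe_smul c x] with s hs
    rw [hs, inner_smul_left]
  definite x hx := by
    have h : ∫ s, ‖x s‖ ^ 2 ∂μ = 0 := by
      have h1 := integral_re (𝓕.integrable_inner x.repr x.repr)
      have h2 : RCLike.re (∫ s, inner ℂ (x s) (x s) ∂μ) = 0 := by
        rw [show ∫ s, inner ℂ (x s) (x s) ∂μ = 0 from hx]
        simp
      rw [← h1] at h2
      rw [← h2]
      refine integral_congr_ae (Eventually.of_forall fun s => ?_)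
      exact norm_sq_eq_re_inner (𝕜 := ℂ) (x s)
    rw [integral_eq_zero_iff_of_nonneg (fun s => by positivity) x.repr.2.2] at h
    refine ext_ae ?_
    filter_upwards [h, coe_zero (𝓕 := 𝓕)] with s hs h0
    rw [h0]
    simpa using hs

instance : NormedAddCommGroup (DirectIntegral 𝓕) :=
  innerCore.toNormedAddCommGroup

instance : InnerProductSpace ℂ (DirectIntegral 𝓕) :=
  InnerProductSpace.ofCore innerCore.toCore

theorem inner_def (x y : DirectIntegral 𝓕) :
    inner ℂ x y = ∫ s, inner ℂ (x s) (y s) ∂μ := rfl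

end DirectIntegral

/-! ### Measurable fields of operators and their direct integral -/

/-- A bounded measurable field of (bounded) operators: `s ↦ ⟨T(s) x(s), y(s)⟩_s` is `μ`-measurable
for all measurable sections `x`, `y`, and `s ↦ ‖T(s)‖` is essentially bounded. -/
structure IsBoundedMeasurableField (T : ∀ s, H s →L[ℂ] H s) : Prop where
  aemeasurable_inner : ∀ x ∈ 𝓕.sections, ∀ y ∈ 𝓕.sections,
    AEMeasurable (fun s => inner ℂ (T s (x s)) (y s)) μ
  essBounded : ∃ C : ℝ, ∀ᵐ s ∂μ, ‖T s‖ ≤ C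

/-- A measurable field of closed operators: a family of closed operators such that some fixed `ν`
lies in the resolvent set of `A(s)` for a.e. `s`, and the resolvents `R(ν, A(s))`, adjusted on a
null set, form a bounded measurable field of operators. -/
structure IsMeasurableFieldOfClosed (A : ∀ s, H s →ₗ.[ℂ] H s) : Prop where
  isClosed : ∀ s, (A s).IsClosed
  exists_resolvent : ∃ (ν : ℂ) (R : ∀ s, H s →L[ℂ] H s),
    IsBoundedMeasurableField 𝓕 R ∧ ∀ᵐ s ∂μ, IsResolventAt (A s) ν (R s)

/-- The graph of `∫^⊕ A(s) dμ(s)`: all pairs `(x, y)` in the direct integral of the `H s` with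
`x(s) ∈ D(A(s))` and `A(s) x(s) = y(s)` for a.e. `s`. -/
def directIntegralGraph (A : ∀ s, H s →ₗ.[ℂ] H s) :
    Submodule ℂ (DirectIntegral 𝓕 × DirectIntegral 𝓕) where
  carrier := {p | ∀ᵐ s ∂μ, ∃ h : p.1 s ∈ (A s).domain, A s ⟨p.1 s, h⟩ = p.2 s}
  zero_mem' := by
    filter_upwards [DirectIntegral.coe_zero (𝓕 := 𝓕)] with s hs
    have : ((0 : DirectIntegral 𝓕) s, (0 : DirectIntegral 𝓕) s) ∈ (A s).graph := by
      rw [hs]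
      exact (A s).graph.zero_mem
    simpa [LinearPMap.mem_graph_iff] using this
  add_mem' := by
    intro p q hp hq
    filter_upwards [hp, hq, DirectIntegral.coe_add p.1 q.1, DirectIntegral.coe_add p.2 q.2]
      with s ⟨h1, e1⟩ ⟨h2, e2⟩ a1 a2
    have h : (p + q).1 s ∈ (A s).domain := by
      rw [Prod.fst_add, a1]
      exact (A s).domain.add_mem h1 h2
    refine ⟨h, ?_⟩
    rw [Prod.snd_add, a2, ← e1, ← e2, ← LinearPMap.map_add]
    congr 1
    exact Subtype.ext a1
  smul_mem' := by
    intro c p hp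
    filter_upwards [hp, DirectIntegral.coe_smul c p.1, DirectIntegral.coe_smul c p.2]
      with s ⟨h1, e1⟩ a1 a2
    have h : (c • p).1 s ∈ (A s).domain := by
      rw [Prod.smul_fst, a1]
      exact (A s).domain.smul_mem c h1
    refine ⟨h, ?_⟩
    rw [Prod.smul_snd, a2, ← e1, ← LinearPMap.map_smul]
    congr 1
    exact Subtype.ext a1

/-- The operator `∫^⊕ A(s) dμ(s)` with its maximal domain: `x` belongs to the domain if and only
if `x(s) ∈ D(A(s))` for a.e. `s` and `s ↦ A(s) x(s)` is again in the direct integral of the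
`H s`, and it is mapped to this section. -/
def directIntegralOp (A : ∀ s, H s →ₗ.[ℂ] H s) : DirectIntegral 𝓕 →ₗ.[ℂ] DirectIntegral 𝓕 :=
  (directIntegralGraph 𝓕 A).toLinearPMap

theorem mem_graph_directIntegralOp (A : ∀ s, H s →ₗ.[ℂ] H s) (x y : DirectIntegral 𝓕) :
    (x, y) ∈ (directIntegralOp 𝓕 A).graph ↔
      ∀ᵐ s ∂μ, ∃ h : x s ∈ (A s).domain, A s ⟨x s, h⟩ = y s := by
  rw [directIntegralOp, Submodule.toLinearPMap_graph_eq]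
  · rfl
  · rintro ⟨a, b⟩ hab ha
    have ha' : a = 0 := ha
    subst ha'
    refine DirectIntegral.ext_ae ?_
    filter_upwards [hab, DirectIntegral.coe_zero (𝓕 := 𝓕)] with s ⟨h, e⟩ h0
    rw [h0, ← e]
    have : (⟨(0 : DirectIntegral 𝓕) s, h⟩ : (A s).domain) = 0 := Subtype.ext h0
    rw [this, LinearPMap.map_zero]

/-- `B = ∫^⊕ A(s) dμ(s)`, in the sense that `A` is a measurable field of closed operators and
`B` is its direct integral. -/
def IsDirectIntegralOf (B : DirectIntegral 𝓕 →ₗ.[ℂ] DirectIntegral 𝓕)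
    (A : ∀ s, H s →ₗ.[ℂ] H s) : Prop :=
  IsMeasurableFieldOfClosed 𝓕 A ∧ B = directIntegralOp 𝓕 A

/-- `‖T^t(s)‖ ≤ M e^{ω t}` for a.e. `s` and all `t > 0`. -/
def UniformlyExpBounded (μ : Measure Ω) (T : ∀ s, ℝ≥0 → H s →L[ℂ] H s) (M ω : ℝ) : Prop :=
  ∀ᵐ s ∂μ, ∀ t : ℝ≥0, 0 < t → ‖T s t‖ ≤ M * Real.exp (ω * t)

end Fields

end

/-!
The forward implication rests on two facts. The direct integral is complete
(the Riesz–Fischer theorem), so the uniform boundedness principle gives every `C₀`-semigroup on it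
an exponential bound (`IsC0Semigroup.exists_exp_bound`). A decomposable operator dominates almost
all of its fibres in norm (`DirectIntegral.ae_opNorm_le`); using this at countably many times and
then strong continuity in the fibres, the exponential bound passes to almost all fibres.
Conversely, a uniform bound on the fibres gives the same bound on `T(t)`, and strong continuity of
`T` follows by dominated convergence (`DirectIntegral.tendsto_of_dominated`).

For the generator, the resolvent of each fibre generator at `ν > ω` is the Laplace transform
`x ↦ ∫₀^∞ e^{-νt} T^t(s) x dt`. Its dependence on `s` is measurable because the integrand is
measurable in `s` and continuous in `t` (`aemeasurable_setIntegral_of_continuous`), so the fibre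
generators form a measurable field of closed operators. Their direct integral is contained in the
generator of `T`: the difference quotients converge in each fibre and are dominated by means of the
mean value inequality (`IsC0Semigroup.norm_sub_le_of_mem_graph`). Equality holds because `ν` minus
the smaller operator is onto, by integrating the fibre resolvents, whereas `ν` minus the larger one
is injective.
-/

/-! ### Exponential bounds and resolvents of `C₀`-semigroups -/

section AbstractSemigroups

variable {X : Type*} [NormedAddCommGroup X] [NormedSpace ℂ X]

theorem LinearPMap.mem_graph_iff_exists_mem_domain (A : X →ₗ.[ℂ] X) (x y : X) :
    (x, y) ∈ A.graph ↔ ∃ h : x ∈ A.domain, A ⟨x, h⟩ = y := by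
  rw [LinearPMap.mem_graph_iff]
  constructor
  · rintro ⟨⟨a, ha⟩, rfl, h⟩
    exact ⟨ha, h⟩
  · rintro ⟨h, e⟩
    exact ⟨⟨x, h⟩, rfl, e⟩

theorem isResolventAt_iff_graph (A : X →ₗ.[ℂ] X) (z : ℂ) (R : X →L[ℂ] X) :
    IsResolventAt A z R ↔ (∀ y, (R y, z • R y - y) ∈ A.graph) ∧
      ∀ x y, (x, y) ∈ A.graph → R (z • x - y) = x := by
  simp only [IsResolventAt, LinearPMap.mem_graph_iff_exists_mem_domain]
  refine and_congr (forall_congr' fun y => exists_congr fun h => ?_) ?_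
  · rw [sub_eq_iff_eq_add, eq_sub_iff_add_eq, eq_comm, add_comm]
  · constructor
    · rintro h x _ ⟨hx, rfl⟩
      exact h ⟨x, hx⟩
    · exact fun h x => h x _ ⟨x.2, rfl⟩

theorem NNReal.tendsto_coe_nhdsGT_zero :
    Tendsto (fun t : ℝ≥0 => (t : ℝ)) (𝓝[>] 0) (𝓝[≠] 0) := by
  refine tendsto_nhdsWithin_iff.2 ⟨?_, ?_⟩
  · exact (NNReal.continuous_coe.tendsto 0).mono_left nhdsWithin_le_nhds
  · filter_upwards [self_mem_nhdsWithin] with t ht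
    exact (NNReal.coe_pos.2 ht).ne'

namespace IsC0Semigroup

variable {T : ℝ≥0 → X →L[ℂ] X} {M ω ν : ℝ}

/-- The uniform boundedness principle bounds `T` on `[0, 1]`, and the semigroup law propagates
this bound geometrically. -/
theorem exists_exp_bound [CompleteSpace X] (hT : IsC0Semigroup T) :
    ∃ M ω : ℝ, 1 ≤ M ∧ ∀ t : ℝ≥0, ‖T t‖ ≤ M * Real.exp (ω * t) := by
  obtain ⟨C, hC⟩ : ∃ C, ∀ r : Set.Icc (0 : ℝ≥0) 1, ‖T r‖ ≤ C := by
    refine banach_steinhaus fun x => ?_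
    obtain ⟨C, hC⟩ :=
      ((isCompact_Icc (a := (0 : ℝ≥0)) (b := 1)).image
        (hT.continuous_orbit x)).isBounded.exists_norm_le
    exact ⟨C, fun r => hC _ ⟨r, r.2, rfl⟩⟩
  set M := max C 1
  have hM : 1 ≤ M := le_max_right _ _
  have hM0 : 0 < M := one_pos.trans_le hM
  have hr : ∀ r : ℝ≥0, r ≤ 1 → ‖T r‖ ≤ M := fun r hr =>
    (hC ⟨r, zero_le, hr⟩).trans (le_max_left _ _)
  have hn : ∀ (n : ℕ) (r : ℝ≥0), r ≤ 1 → ‖T (n + r)‖ ≤ M * M ^ n := by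
    intro n r h1
    induction n with
    | zero => simpa using hr r h1
    | succ n ih =>
      have e : ((n + 1 : ℕ) : ℝ≥0) + r = 1 + (n + r) := by push_cast; ring
      rw [e, hT.map_add]
      calc ‖(T 1).comp (T (n + r))‖ ≤ ‖T 1‖ * ‖T (n + r)‖ :=
            ContinuousLinearMap.opNorm_comp_le _ _
        _ ≤ M * (M * M ^ n) := by
            gcongr
            exact hr 1 le_rfl
        _ = M * M ^ (n + 1) := by ring
  refine ⟨M, Real.log M, hM, fun t => ?_⟩
  have hfl : (⌊t⌋₊ : ℝ≥0) ≤ t := Nat.floor_le zero_le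
  have h := hn ⌊t⌋₊ (t - ⌊t⌋₊) (by
    rw [tsub_le_iff_right, add_comm]
    exact (Nat.lt_floor_add_one t).le)
  rw [add_tsub_cancel_of_le hfl] at h
  refine h.trans ?_
  gcongr
  calc M ^ ⌊t⌋₊ = Real.exp (Real.log M * ⌊t⌋₊) := by
        rw [mul_comm, Real.exp_nat_mul, Real.exp_log hM0]
    _ ≤ Real.exp (Real.log M * t) := by
        gcongr
        · exact Real.log_nonneg hM
        · exact_mod_cast hfl

theorem continuous_orbit_toNNReal (hT : IsC0Semigroup T) (x : X) :
    Continuous fun t : ℝ => T t.toNNReal x :=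
  (hT.continuous_orbit x).comp continuous_real_toNNReal

theorem continuous_laplace_integrand (hT : IsC0Semigroup T) (ν : ℝ) (x : X) :
    Continuous fun t : ℝ => Real.exp (-ν * t) • T t.toNNReal x :=
  (by fun_prop : Continuous fun t : ℝ => Real.exp (-ν * t)).smul (hT.continuous_orbit_toNNReal x)

theorem norm_laplace_integrand_le (hb : ∀ t : ℝ≥0, ‖T t‖ ≤ M * Real.exp (ω * t)) (x : X)
    {t : ℝ} (ht : 0 ≤ t) :
    ‖Real.exp (-ν * t) • T t.toNNReal x‖ ≤ M * ‖x‖ * Real.exp (-(ν - ω) * t) := by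
  have h := (T t.toNNReal).le_of_opNorm_le (hb _) x
  rw [Real.coe_toNNReal _ ht] at h
  rw [norm_smul, Real.norm_eq_abs, Real.abs_exp]
  calc Real.exp (-ν * t) * ‖T t.toNNReal x‖
      ≤ Real.exp (-ν * t) * (M * Real.exp (ω * t) * ‖x‖) := by gcongr
    _ = M * ‖x‖ * (Real.exp (-ν * t) * Real.exp (ω * t)) := by ring
    _ = _ := by rw [← Real.exp_add]; ring_nf

theorem integrableOn_laplace_integrand (hT : IsC0Semigroup T)
    (hb : ∀ t : ℝ≥0, ‖T t‖ ≤ M * Real.exp (ω * t)) (hν : ω < ν) (x : X) :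
    IntegrableOn (fun t : ℝ => Real.exp (-ν * t) • T t.toNNReal x) (Set.Ioi 0) := by
  refine Integrable.mono' ((exp_neg_integrableOn_Ioi 0 (sub_pos.2 hν)).const_mul (M * ‖x‖))
    (hT.continuous_laplace_integrand ν x).aestronglyMeasurable ?_
  filter_upwards [ae_restrict_mem measurableSet_Ioi] with t ht
  exact norm_laplace_integrand_le hb x (le_of_lt ht)

/-- The Laplace transform `x ↦ ∫₀^∞ e^{-νt} T(t) x dt` of an exponentially bounded semigroup is a
bounded operator. -/
theorem exists_laplace [CompleteSpace X] (hT : IsC0Semigroup T)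
    (hb : ∀ t : ℝ≥0, ‖T t‖ ≤ M * Real.exp (ω * t)) (hν : ω < ν) :
    ∃ R : X →L[ℂ] X, (∀ x, ‖R x‖ ≤ M / (ν - ω) * ‖x‖) ∧
      ∀ x, R x = ∫ t in Set.Ioi (0 : ℝ), Real.exp (-ν * t) • T t.toNNReal x := by
  have hbound : ∀ x, ‖∫ t in Set.Ioi (0 : ℝ), Real.exp (-ν * t) • T t.toNNReal x‖ ≤
      M / (ν - ω) * ‖x‖ := by
    intro x
    have h0 : 0 < ν - ω := sub_pos.2 hν
    refine (norm_integral_le_of_norm_le ((exp_neg_integrableOn_Ioi 0 h0).const_mul (M * ‖x‖))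
      ?_).trans_eq ?_
    · filter_upwards [ae_restrict_mem measurableSet_Ioi] with t ht
      exact norm_laplace_integrand_le hb x (le_of_lt ht)
    · rw [integral_const_mul, integral_exp_mul_Ioi (neg_lt_zero.2 h0)]
      field_simp
      simp
  refine ⟨LinearMap.mkContinuous
    { toFun := fun x => ∫ t in Set.Ioi (0 : ℝ), Real.exp (-ν * t) • T t.toNNReal x
      map_add' := fun x y => ?_
      map_smul' := fun c x => ?_ } (M / (ν - ω)) hbound, hbound, fun x => rfl⟩
  · simp only [_root_.map_add, smul_add]
    exact integral_add (hT.integrableOn_laplace_integrand hb hν x)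
      (hT.integrableOn_laplace_integrand hb hν y)
  · simp only [map_smul, smul_comm _ c, integral_smul, RingHom.id_apply]

/-- `T(h) R x = e^{νh} (R x - ∫₀^h e^{-νt} T(t) x dt)` for the Laplace transform `R`; hence
`h ↦ T(h) R x` has right derivative `ν R x - x` at `0`. -/
theorem laplace_mem_graph_generator [CompleteSpace X] (hT : IsC0Semigroup T)
    (hb : ∀ t : ℝ≥0, ‖T t‖ ≤ M * Real.exp (ω * t)) (hν : ω < ν) {R : X →L[ℂ] X}
    (hR : ∀ x, R x = ∫ t in Set.Ioi (0 : ℝ), Real.exp (-ν * t) • T t.toNNReal x) (x : X) :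
    (R x, (ν : ℂ) • R x - x) ∈ (generator T).graph := by
  rw [mem_graph_generator]
  set f : ℝ → X := fun t => Real.exp (-ν * t) • T t.toNNReal x with hf
  have hfc : Continuous f := hT.continuous_laplace_integrand ν x
  have hfi : IntegrableOn f (Set.Ioi 0) := hT.integrableOn_laplace_integrand hb hν x
  have key : ∀ h : ℝ≥0, T h (R x) = Real.exp (ν * h) • (R x - ∫ t in (0 : ℝ)..h, f t) := by
    intro h
    have hh : (0 : ℝ) ≤ h := h.2
    have e1 : R x - ∫ t in (0 : ℝ)..h, f t = ∫ t in Set.Ioi (h : ℝ), f t := by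
      rw [hR, sub_eq_iff_eq_add, add_comm]
      exact (intervalIntegral.integral_interval_add_Ioi hfi
        (hfi.mono_set (Set.Ioi_subset_Ioi hh))).symm
    have e2 : ∫ t in Set.Ioi (h : ℝ), f t = ∫ t in Set.Ioi (0 : ℝ), f (t + h) := by
      have h1 := (measurePreserving_add_right volume (h : ℝ)).setIntegral_preimage_emb
        (measurableEmbedding_addRight (h : ℝ)) f (Set.Ioi (h : ℝ))
      rw [← h1, Set.preimage_add_const_Ioi, sub_self]
    rw [e1, e2, hR, ← integral_smul, ← ContinuousLinearMap.integral_comp_comm _ hfi]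
    refine setIntegral_congr_fun measurableSet_Ioi fun t ht => ?_
    have ht0 : (0 : ℝ) ≤ t := le_of_lt ht
    have e3 : (t + h).toNNReal = h + t.toNNReal := by
      rw [Real.toNNReal_add ht0 hh, Real.toNNReal_coe, add_comm]
    simp only [hf]
    rw [e3, hT.map_add, smul_smul, ← Real.exp_add, ContinuousLinearMap.comp_apply,
      ContinuousLinearMap.map_smul_of_tower]
    congr 2
    ring
  have hderiv : HasDerivAt (fun h : ℝ => Real.exp (ν * h) • (R x - ∫ t in (0 : ℝ)..h, f t))
      ((ν : ℂ) • R x - x) 0 := by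
    have d1 : HasDerivAt (fun h : ℝ => Real.exp (ν * h)) ν 0 := by
      simpa using ((hasDerivAt_id (0 : ℝ)).const_mul ν).exp
    have d2 : HasDerivAt (fun h : ℝ => R x - ∫ t in (0 : ℝ)..h, f t) (-f 0) 0 :=
      (hfc.integral_hasStrictDerivAt 0 0).hasDerivAt.const_sub (R x)
    refine (d1.fun_smul d2).congr_deriv ?_
    simp [hf, hT.map_zero]
    abel
  refine ((hasDerivAt_iff_tendsto_slope.1 hderiv).comp
    NNReal.tendsto_coe_nhdsGT_zero).congr fun h => ?_
  simp only [Function.comp_apply, slope_def_module, ← key]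
  simp [← Complex.ofReal_inv]

/-- The Laplace transform commutes with the semigroup. -/
theorem laplace_comm (hT : IsC0Semigroup T) [CompleteSpace X]
    (hb : ∀ t : ℝ≥0, ‖T t‖ ≤ M * Real.exp (ω * t)) (hν : ω < ν) {R : X →L[ℂ] X}
    (hR : ∀ x, R x = ∫ t in Set.Ioi (0 : ℝ), Real.exp (-ν * t) • T t.toNNReal x) (h : ℝ≥0)
    (x : X) : T h (R x) = R (T h x) := by
  rw [hR, hR, ← ContinuousLinearMap.integral_comp_comm _
    (hT.integrableOn_laplace_integrand hb hν x)]
  congr 1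
  ext t
  rw [ContinuousLinearMap.map_smul_of_tower, ← ContinuousLinearMap.comp_apply,
    ← ContinuousLinearMap.comp_apply, ← hT.map_add, ← hT.map_add, add_comm]

theorem isResolventAt_laplace [CompleteSpace X] (hT : IsC0Semigroup T)
    (hb : ∀ t : ℝ≥0, ‖T t‖ ≤ M * Real.exp (ω * t)) (hν : ω < ν) {R : X →L[ℂ] X}
    (hR : ∀ x, R x = ∫ t in Set.Ioi (0 : ℝ), Real.exp (-ν * t) • T t.toNNReal x) :
    IsResolventAt (generator T) ν R := by
  refine (isResolventAt_iff_graph _ _ _).2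
    ⟨hT.laplace_mem_graph_generator hb hν hR, fun x y hxy => ?_⟩
  -- `R A x` and `A R x` are both the limit of `R (T(h) x - x) / h`.
  have h1 := (mem_graph_generator _ _ _).1 (hT.laplace_mem_graph_generator hb hν hR x)
  have h2 := (R.continuous.tendsto _).comp ((mem_graph_generator _ _ _).1 hxy)
  have h3 := tendsto_nhds_unique h1 (h2.congr fun h => by
    simp only [Function.comp_apply, map_smul, map_sub, hT.laplace_comm hb hν hR])
  rw [map_sub, map_smul, ← h3, sub_sub_cancel]

/-- The mean value inequality along the orbit of a vector `x` of the domain, whose right derivative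
at time `u` is `T(u) A x`. -/
theorem norm_sub_le_of_mem_graph (hT : IsC0Semigroup T) {x y : X}
    (hxy : (x, y) ∈ (generator T).graph) {C : ℝ} {t : ℝ≥0} (hC : ∀ u ≤ t, ‖T u‖ ≤ C) :
    ‖T t x - x‖ ≤ C * ‖y‖ * t := by
  rw [mem_graph_generator] at hxy
  have hd : ∀ u ∈ Set.Ico (0 : ℝ) t, HasDerivWithinAt (fun u : ℝ => T u.toNNReal x)
      (T u.toNNReal y) (Set.Ici u) u := by
    intro u hu
    rw [hasDerivWithinAt_iff_tendsto_slope, Set.Ici_sdiff_left]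
    have hmap : Tendsto (fun v : ℝ => (v - u).toNNReal) (𝓝[>] u) (𝓝[>] 0) := by
      refine tendsto_nhdsWithin_iff.2 ⟨?_, ?_⟩
      · have : Continuous fun v : ℝ => (v - u).toNNReal := by fun_prop
        simpa using (this.tendsto u).mono_left nhdsWithin_le_nhds
      · filter_upwards [self_mem_nhdsWithin] with v hv
        exact Real.toNNReal_pos.2 (sub_pos.2 hv)
    refine Tendsto.congr' ?_ (((T u.toNNReal).continuous.tendsto y).comp (hxy.comp hmap))
    filter_upwards [self_mem_nhdsWithin] with v hv
    have hv' : 0 < v - u := sub_pos.2 hv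
    have e : v.toNNReal = u.toNNReal + (v - u).toNNReal := by
      rw [← Real.toNNReal_add hu.1 hv'.le, add_sub_cancel]
    simp only [Function.comp_apply, slope_def_module, map_smul, map_sub]
    rw [e, hT.map_add, ContinuousLinearMap.comp_apply, Real.coe_toNNReal _ hv'.le,
      ← Complex.ofReal_inv, Complex.coe_smul]
  have h := norm_image_sub_le_of_norm_deriv_right_le_segment
    (hT.continuous_orbit_toNNReal x).continuousOn hd (C := C * ‖y‖) (fun u hu =>
      (T u.toNNReal).le_of_opNorm_le (hC _ (by
        rw [← Real.toNNReal_coe (r := t)]; exact Real.toNNReal_le_toNNReal hu.2.le)) y)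
    t ⟨t.2, le_rfl⟩
  simpa [hT.map_zero] using h

end IsC0Semigroup

end AbstractSemigroups

/-! ### Measurable sections -/

section DirectIntegrals

variable {Ω : Type*} [MeasurableSpace Ω] {μ : Measure Ω}
  {H : Ω → Type*} [∀ s, NormedAddCommGroup (H s)] [∀ s, InnerProductSpace ℂ (H s)]

/-- The integral in time of a function that is `μ`-measurable in `s` and continuous in time is
`μ`-measurable. Off a single null set, all values at rational times agree with measurable versions,
so the function has a jointly measurable version. -/
theorem aemeasurable_setIntegral_of_continuous {f : Ω → ℝ → ℂ}
    (hm : ∀ t, AEMeasurable (fun s => f s t) μ) (hc : ∀ s, Continuous (f s)) (E : Set ℝ) :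
    AEMeasurable (fun s => ∫ t in E, f s t) μ := by
  have hq : ∀ᵐ s ∂μ, ∀ q : ℚ, f s q = (hm q).mk _ s := ae_all_iff.2 fun q => (hm q).ae_eq_mk
  obtain ⟨N, hN, hNm, hN0⟩ := exists_measurable_superset_of_null hq
  let g : Ω → ℝ → ℂ := fun s t => Nᶜ.indicator (fun s => f s t) s
  have hgc : ∀ s, Continuous (g s) := by
    intro s
    by_cases hs : s ∈ N
    · simpa [g, hs] using continuous_const
    · simpa [g, hs] using hc s
  have hgq : ∀ q : ℚ, Measurable fun s => g s q := by
    intro q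
    have : (fun s => g s q) = Nᶜ.indicator ((hm q).mk _) := by
      ext s
      by_cases hs : s ∈ N
      · simp [g, hs]
      · have := not_not.1 (fun h => hs (hN h)) q
        simp only [g, Set.indicator_of_mem (Set.mem_compl hs), this]
    rw [this]
    exact (hm q).measurable_mk.indicator hNm.compl
  have hgm : ∀ t : ℝ, Measurable fun s => g s t := by
    intro t
    obtain ⟨v, -, -, hv⟩ := Real.exists_seq_rat_strictMono_tendsto t
    exact measurable_of_tendsto_metrizable (fun n => hgq (v n))
      (tendsto_pi_nhds.2 fun s => ((hgc s).tendsto t).comp hv)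
  have hu := (measurable_uncurry_of_continuous_of_measurable
    (u := fun (t : ℝ) (s : Ω) => g s t) hgc hgm).comp measurable_swap
  have hi : StronglyMeasurable fun s => ∫ t in E, g s t :=
    StronglyMeasurable.integral_prod_right (f := g) hu.stronglyMeasurable
  refine ⟨_, hi.measurable, ?_⟩
  filter_upwards [measure_eq_zero_iff_ae_notMem.1 hN0] with s hs
  simp [g, hs]

namespace MeasurableHilbertField

variable (𝓕 : MeasurableHilbertField μ H)

theorem fun_smul_mem {c : Ω → ℂ} (hc : AEMeasurable c μ) {x : ∀ s, H s} (hx : x ∈ 𝓕.sections) :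
    (fun s => c s • x s) ∈ 𝓕.sections := by
  refine 𝓕.mem_of_aemeasurable_inner _ fun z hz => ?_
  simp only [inner_smul_right]
  exact hc.mul (𝓕.aemeasurable_inner z hz x hx)

theorem mem_of_ae_eq {x y : ∀ s, H s} (hx : x ∈ 𝓕.sections) (h : ∀ᵐ s ∂μ, x s = y s) :
    y ∈ 𝓕.sections := by
  refine 𝓕.mem_of_aemeasurable_inner _ fun z hz => ?_
  refine (𝓕.aemeasurable_inner z hz x hx).congr ?_
  filter_upwards [h] with s hs
  rw [hs]

theorem mem_of_ae_tendsto {u : ℕ → ∀ s, H s} {x : ∀ s, H s} (hu : ∀ n, u n ∈ 𝓕.sections)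
    (h : ∀ᵐ s ∂μ, Tendsto (fun n => u n s) atTop (𝓝 (x s))) : x ∈ 𝓕.sections := by
  refine 𝓕.mem_of_aemeasurable_inner _ fun z hz => ?_
  refine aemeasurable_of_tendsto_metrizable_ae atTop
    (fun n => 𝓕.aemeasurable_inner z hz (u n) (hu n)) ?_
  filter_upwards [h] with s hs
  exact tendsto_const_nhds.inner hs

/-- On a `σ`-finite space every measurable section becomes square-integrable after multiplication
by a positive measurable function. This reduces questions about measurable sections to the direct
integral. -/
theorem exists_pos_smul_mem_squareIntegrable [SigmaFinite μ] {x : ∀ s, H s}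
    (hx : x ∈ 𝓕.sections) :
    ∃ c : Ω → ℝ, (∀ s, 0 < c s) ∧ AEMeasurable c μ ∧
      (fun s => (c s : ℂ) • x s) ∈ 𝓕.squareIntegrable := by
  obtain ⟨g, hg0, hgm, hg⟩ := exists_pos_lintegral_lt_of_sigmaFinite μ one_ne_zero
  have hn := 𝓕.aemeasurable_norm hx
  have hc : AEMeasurable (fun s => √(g s : ℝ) / (1 + ‖x s‖)) μ :=
    (hgm.coe_nnreal_real.sqrt.aemeasurable).div (hn.const_add 1)
  have hmem := 𝓕.fun_smul_mem (Complex.measurable_ofReal.comp_aemeasurable hc) hx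
  refine ⟨fun s => √(g s : ℝ) / (1 + ‖x s‖), fun s => ?_, hc, hmem, ?_⟩
  · have : (0 : ℝ) < g s := hg0 s
    positivity
  · have hgi : Integrable (fun s => (g s : ℝ)) μ := by
      refine ⟨hgm.coe_nnreal_real.aestronglyMeasurable, ?_⟩
      refine lt_of_le_of_lt (lintegral_mono fun s => ?_) (hg.trans ENNReal.one_lt_top)
      simp
    refine hgi.mono' ((𝓕.aemeasurable_norm hmem).pow_const 2).aestronglyMeasurable
      (Eventually.of_forall fun s => ?_)
    have h1 : ‖x s‖ / (1 + ‖x s‖) ≤ 1 :=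
      div_le_one_of_le₀ (by linarith [norm_nonneg (x s)]) (by positivity)
    rw [Real.norm_eq_abs, abs_pow, abs_norm, norm_smul, Complex.norm_real, Real.norm_eq_abs,
      abs_of_nonneg (by positivity), div_mul_eq_mul_div, mul_div_assoc, mul_pow,
      Real.sq_sqrt (NNReal.coe_nonneg _)]
    exact mul_le_of_le_one_right (g s).2 (pow_le_one₀ (by positivity) h1)

end MeasurableHilbertField

/-! ### Dominated convergence and completeness of the direct integral -/

namespace DirectIntegral

variable {𝓕 : MeasurableHilbertField μ H}

theorem coe_mem (x : DirectIntegral 𝓕) : (x : ∀ s, H s) ∈ 𝓕.sections := x.repr.2.1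

theorem integrable_norm_sq (x : DirectIntegral 𝓕) : Integrable (fun s => ‖x s‖ ^ 2) μ :=
  x.repr.2.2

theorem coe_sub (x y : DirectIntegral 𝓕) : ∀ᵐ s ∂μ, (x - y) s = x s - y s := by
  filter_upwards [coe_add (x - y) y] with s hs
  rw [sub_add_cancel] at hs
  rw [hs, add_sub_cancel_right]

theorem norm_sq_eq (x : DirectIntegral 𝓕) : ‖x‖ ^ 2 = ∫ s, ‖x s‖ ^ 2 ∂μ := by
  rw [norm_sq_eq_re_inner (𝕜 := ℂ), inner_def,
    ← integral_re (𝓕.integrable_inner x.repr x.repr)]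
  refine integral_congr_ae (Eventually.of_forall fun s => ?_)
  exact (norm_sq_eq_re_inner (𝕜 := ℂ) (x s)).symm

theorem norm_sq_eq_of_ae_eq {x : DirectIntegral 𝓕} {z : ∀ s, H s} (h : ∀ᵐ s ∂μ, x s = z s) :
    ‖x‖ ^ 2 = ∫ s, ‖z s‖ ^ 2 ∂μ := by
  rw [norm_sq_eq]
  refine integral_congr_ae ?_
  filter_upwards [h] with s hs
  rw [hs]

theorem integrable_norm_sq_of_ae_eq {x : DirectIntegral 𝓕} {z : ∀ s, H s}
    (h : ∀ᵐ s ∂μ, x s = z s) : Integrable (fun s => ‖z s‖ ^ 2) μ := by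
  refine x.integrable_norm_sq.congr ?_
  filter_upwards [h] with s hs
  rw [hs]

theorem lintegral_norm_sq_sub (x y : DirectIntegral 𝓕) :
    ∫⁻ s, ENNReal.ofReal (‖x s - y s‖ ^ 2) ∂μ = ENNReal.ofReal (dist x y ^ 2) := by
  rw [dist_eq_norm, norm_sq_eq_of_ae_eq (coe_sub x y), ofReal_integral_eq_lintegral_ofReal
    (integrable_norm_sq_of_ae_eq (coe_sub x y)) (Eventually.of_forall fun s => by positivity)]

theorem norm_le_mul_of_ae_le {x y : DirectIntegral 𝓕} {C : ℝ} (hC : 0 ≤ C)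
    (h : ∀ᵐ s ∂μ, ‖y s‖ ≤ C * ‖x s‖) : ‖y‖ ≤ C * ‖x‖ := by
  refine le_of_sq_le_sq ?_ (by positivity)
  rw [mul_pow, norm_sq_eq, norm_sq_eq, ← integral_const_mul]
  refine integral_mono_ae y.integrable_norm_sq (x.integrable_norm_sq.const_mul _) ?_
  filter_upwards [h] with s hs
  rw [← mul_pow]
  gcongr

/-- Dominated convergence in the direct integral. The sections `f i` need not be the chosen
representatives of the `x i`, so that pointwise convergence makes sense along uncountable filters. -/
theorem tendsto_of_dominated {ι : Type*} {l : Filter ι} [l.IsCountablyGenerated]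
    {x : ι → DirectIntegral 𝓕} {y : DirectIntegral 𝓕} {f : ι → ∀ s, H s}
    (hf : ∀ i, ∀ᵐ s ∂μ, x i s = f i s) {bound : Ω → ℝ} (hbi : Integrable (fun s => bound s ^ 2) μ)
    (hb : ∀ᶠ i in l, ∀ᵐ s ∂μ, ‖f i s - y s‖ ≤ bound s)
    (h : ∀ᵐ s ∂μ, Tendsto (fun i => f i s) l (𝓝 (y s))) : Tendsto x l (𝓝 y) := by
  rw [tendsto_iff_norm_sub_tendsto_zero]
  have he : ∀ i, ∀ᵐ s ∂μ, (x i - y) s = f i s - y s := by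
    intro i
    filter_upwards [hf i, coe_sub (x i) y] with s h1 h2
    rw [h2, h1]
  have key : Tendsto (fun i => ∫ s, ‖f i s - y s‖ ^ 2 ∂μ) l (𝓝 (∫ _, (0 : ℝ) ∂μ)) := by
    refine tendsto_integral_filter_of_dominated_convergence (fun s => bound s ^ 2)
      (Eventually.of_forall fun i => (integrable_norm_sq_of_ae_eq (he i)).aestronglyMeasurable)
      ?_ hbi ?_
    · filter_upwards [hb] with i hi
      filter_upwards [hi] with s hs
      rw [Real.norm_eq_abs, abs_pow, abs_norm]
      gcongr
    · filter_upwards [h] with s hs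
      simpa using (tendsto_iff_norm_sub_tendsto_zero.1 hs).pow 2
  have h2 := key.sqrt
  simp only [integral_zero, Real.sqrt_zero] at h2
  refine h2.congr fun i => ?_
  rw [← norm_sq_eq_of_ae_eq (he i), Real.sqrt_sq (norm_nonneg _)]

/-- The Riesz–Fischer theorem. If `‖u n - u m‖ < 4⁻ᴺ` for `n, m ≥ N`, then
`∑ₙ 4ⁿ ‖u n s - u (n + 1) s‖²` is integrable, so that `u n s` converges for a.e. `s`, and
Fatou's lemma identifies the pointwise limit as the limit in the direct integral. -/
instance [∀ s, CompleteSpace (H s)] : CompleteSpace (DirectIntegral 𝓕) := by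
  refine Metric.complete_of_convergent_controlled_sequences (fun n => (1 / 4 : ℝ) ^ n)
    (fun n => by positivity) fun u hu => ?_
  have hmeas : ∀ n m, AEMeasurable (fun s => ‖u n s - u m s‖ ^ 2) μ := fun n m =>
    (integrable_norm_sq_of_ae_eq (coe_sub (u n) (u m))).aemeasurable
  have hsum : ∑' n, ∫⁻ s, ENNReal.ofReal (4 ^ n * ‖u n s - u (n + 1) s‖ ^ 2) ∂μ ≠ ⊤ := by
    have hle : ∀ n, ∫⁻ s, ENNReal.ofReal (4 ^ n * ‖u n s - u (n + 1) s‖ ^ 2) ∂μ ≤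
        ENNReal.ofReal ((1 / 4 : ℝ) ^ n) := by
      intro n
      have h4 : (0 : ℝ) ≤ 4 ^ n := by positivity
      simp only [ENNReal.ofReal_mul h4]
      rw [lintegral_const_mul'' _ (hmeas n (n + 1)).ennreal_ofReal, lintegral_norm_sq_sub,
        ← ENNReal.ofReal_mul h4]
      refine ENNReal.ofReal_le_ofReal ?_
      calc (4 : ℝ) ^ n * dist (u n) (u (n + 1)) ^ 2 ≤ 4 ^ n * ((1 / 4 : ℝ) ^ n) ^ 2 := by
            gcongr
            exact (hu n n (n + 1) le_rfl n.le_succ).le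
        _ = (1 / 4 : ℝ) ^ n := by
            rw [pow_two, ← mul_assoc, ← mul_pow]
            norm_num
    refine ne_top_of_le_ne_top ?_ (ENNReal.tsum_le_tsum hle)
    rw [← ENNReal.ofReal_tsum_of_nonneg (fun n => by positivity)
      (summable_geometric_of_lt_one (by norm_num) (by norm_num))]
    exact ENNReal.ofReal_ne_top
  have hcauchy : ∀ᵐ s ∂μ, CauchySeq fun n => u n s := by
    rw [← lintegral_tsum fun n => ((hmeas n (n + 1)).const_mul _).ennreal_ofReal] at hsum
    filter_upwards [ae_lt_top' (AEMeasurable.tsum fun n =>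
      ((hmeas n (n + 1)).const_mul _).ennreal_ofReal) hsum] with s hs
    set C := ∑' n, ENNReal.ofReal (4 ^ n * ‖u n s - u (n + 1) s‖ ^ 2)
    refine cauchySeq_of_le_geometric (1 / 2) (√C.toReal) (by norm_num) fun n => ?_
    have h1 : 4 ^ n * ‖u n s - u (n + 1) s‖ ^ 2 ≤ C.toReal :=
      (ENNReal.ofReal_le_iff_le_toReal hs.ne).1 (ENNReal.le_tsum n)
    have h2 : 2 ^ n * ‖u n s - u (n + 1) s‖ ≤ √C.toReal := by
      refine Real.le_sqrt_of_sq_le ?_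
      rw [mul_pow, ← pow_mul, mul_comm n 2, pow_mul]
      norm_num
      exact h1
    rw [dist_eq_norm, one_div, inv_pow, ← div_eq_mul_inv, le_div_iff₀' (by positivity)]
    exact h2
  have hlim : ∀ s, ∃ l : H s,
      CauchySeq (fun n => u n s) → Tendsto (fun n => u n s) atTop (𝓝 l) := by
    intro s
    by_cases hs : CauchySeq fun n => u n s
    · obtain ⟨l, hl⟩ := cauchySeq_tendsto_of_complete hs
      exact ⟨l, fun _ => hl⟩
    · exact ⟨0, fun h => absurd h hs⟩
  choose x hx using hlim
  have hxt : ∀ᵐ s ∂μ, Tendsto (fun n => u n s) atTop (𝓝 (x s)) := by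
    filter_upwards [hcauchy] with s hs using hx s hs
  have hxm : x ∈ 𝓕.sections := 𝓕.mem_of_ae_tendsto (fun n => (u n).coe_mem) hxt
  have hfatou : ∀ n, ∫⁻ s, ENNReal.ofReal (‖u n s - x s‖ ^ 2) ∂μ ≤
      ENNReal.ofReal (((1 / 4 : ℝ) ^ n) ^ 2) := by
    intro n
    calc ∫⁻ s, ENNReal.ofReal (‖u n s - x s‖ ^ 2) ∂μ
        = ∫⁻ s, liminf (fun m => ENNReal.ofReal (‖u n s - u m s‖ ^ 2)) atTop ∂μ := by
          refine lintegral_congr_ae ?_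
          filter_upwards [hxt] with s hs
          exact (ENNReal.tendsto_ofReal ((tendsto_const_nhds.sub hs).norm.pow 2)).liminf_eq.symm
      _ ≤ liminf (fun m => ∫⁻ s, ENNReal.ofReal (‖u n s - u m s‖ ^ 2) ∂μ) atTop :=
          lintegral_liminf_le' fun m => (hmeas n m).ennreal_ofReal
      _ ≤ _ := by
          refine liminf_le_of_frequently_le' (Eventually.frequently ?_)
          filter_upwards [eventually_ge_atTop n] with m hm
          rw [lintegral_norm_sq_sub]
          refine ENNReal.ofReal_le_ofReal ?_
          gcongr
          exact (hu n n m le_rfl hm).le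
  have hdm : ∀ n, (fun s => u n s - x s) ∈ 𝓕.sections := by
    intro n
    have := 𝓕.add_mem (u n).coe_mem (𝓕.smul_mem (-1) hxm)
    refine 𝓕.mem_of_ae_eq this (Eventually.of_forall fun s => ?_)
    simp [sub_eq_add_neg]
  have hd : ∀ n, (fun s => u n s - x s) ∈ 𝓕.squareIntegrable := fun n =>
    ⟨hdm n, ((𝓕.aemeasurable_norm (hdm n)).pow_const 2).aestronglyMeasurable,
      (hasFiniteIntegral_iff_ofReal (Eventually.of_forall fun s => by positivity)).2
        ((hfatou n).trans_lt ENNReal.ofReal_lt_top)⟩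
  have hxs : x ∈ 𝓕.squareIntegrable := by
    have h := 𝓕.squareIntegrable.sub_mem (u 0).repr.2 (hd 0)
    convert h using 1
    ext s
    simp
  refine ⟨mk ⟨x, hxs⟩, ?_⟩
  have hdist : ∀ n, dist (u n) (mk ⟨x, hxs⟩) ≤ (1 / 4 : ℝ) ^ n := by
    intro n
    refine le_of_sq_le_sq ?_ (by positivity)
    rw [← ENNReal.ofReal_le_ofReal_iff (by positivity), ← lintegral_norm_sq_sub]
    refine le_of_eq_of_le (lintegral_congr_ae ?_) (hfatou n)
    filter_upwards [coe_mk (⟨x, hxs⟩ : 𝓕.squareIntegrable)] with s hs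
    rw [hs]
  exact tendsto_iff_dist_tendsto_zero.2 (squeeze_zero (fun n => dist_nonneg) hdist
    (tendsto_pow_atTop_nhds_zero_of_lt_one (by norm_num) (by norm_num)))

end DirectIntegral

end DirectIntegrals

/-! ### Decomposable operators -/

section OperatorFields

variable {Ω : Type*} [MeasurableSpace Ω] {μ : Measure Ω}
  {H : Ω → Type*} [∀ s, NormedAddCommGroup (H s)] [∀ s, InnerProductSpace ℂ (H s)]
  {𝓕 : MeasurableHilbertField μ H}

theorem mem_graph_directIntegralOp_iff_ae (A : ∀ s, H s →ₗ.[ℂ] H s) (x y : DirectIntegral 𝓕) :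
    (x, y) ∈ (directIntegralOp 𝓕 A).graph ↔ ∀ᵐ s ∂μ, (x s, y s) ∈ (A s).graph := by
  rw [mem_graph_directIntegralOp]
  simp only [LinearPMap.mem_graph_iff_exists_mem_domain]

theorem IsDirectIntegralOf.ae_apply {B : DirectIntegral 𝓕 →L[ℂ] DirectIntegral 𝓕}
    {L : ∀ s, H s →L[ℂ] H s} (h : IsDirectIntegralOf 𝓕 B.toFullPMap fun s => (L s).toFullPMap)
    (x : DirectIntegral 𝓕) : ∀ᵐ s ∂μ, B x s = L s (x s) := by
  have hx : (x, B x) ∈ B.toFullPMap.graph :=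
    (LinearPMap.mem_graph_iff_exists_mem_domain _ _ _).2 ⟨trivial, rfl⟩
  rw [h.2, mem_graph_directIntegralOp] at hx
  filter_upwards [hx] with s ⟨_, e⟩
  exact e.symm

namespace DirectIntegral

variable {B : DirectIntegral 𝓕 →L[ℂ] DirectIntegral 𝓕} {L : ∀ s, H s →L[ℂ] H s}

/-- A decomposable operator also maps measurable sections that are not square-integrable to
measurable sections. -/
theorem fun_apply_mem [SigmaFinite μ] (hB : ∀ x : DirectIntegral 𝓕, ∀ᵐ s ∂μ, B x s = L s (x s))
    {x : ∀ s, H s} (hx : x ∈ 𝓕.sections) : (fun s => L s (x s)) ∈ 𝓕.sections := by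
  obtain ⟨c, hc0, hcm, hc⟩ := 𝓕.exists_pos_smul_mem_squareIntegrable hx
  refine 𝓕.mem_of_ae_eq (𝓕.fun_smul_mem
    (Complex.measurable_ofReal.comp_aemeasurable hcm).inv (B (mk ⟨_, hc⟩)).coe_mem) ?_
  filter_upwards [hB (mk ⟨_, hc⟩), coe_mk (⟨_, hc⟩ : 𝓕.squareIntegrable)] with s h1 h2
  have : (c s : ℂ) ≠ 0 := Complex.ofReal_ne_zero.2 (hc0 s).ne'
  rw [h1, h2, map_smul]
  exact inv_smul_smul₀ this _

/-- Testing `B` on the sections `1_E x`, for all measurable sets `E`, localizes the inequality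
`‖B x‖ ≤ ‖B‖ ‖x‖` to the fibres. -/
theorem ae_norm_apply_le_opNorm (hB : ∀ x : DirectIntegral 𝓕, ∀ᵐ s ∂μ, B x s = L s (x s))
    (x : DirectIntegral 𝓕) : ∀ᵐ s ∂μ, ‖L s (x s)‖ ≤ ‖B‖ * ‖x s‖ := by
  have hi := integrable_norm_sq_of_ae_eq (hB x)
  have key : (fun s => ‖L s (x s)‖ ^ 2) ≤ᵐ[μ] fun s => ‖B‖ ^ 2 * ‖x s‖ ^ 2 := by
    refine ae_le_of_forall_setIntegral_le hi (x.integrable_norm_sq.const_mul _) fun E hE _ => ?_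
    have hx : (fun s => E.indicator (1 : Ω → ℂ) s • x s) ∈ 𝓕.squareIntegrable := by
      refine ⟨𝓕.fun_smul_mem (measurable_one.indicator hE).aemeasurable x.coe_mem, ?_⟩
      refine (x.integrable_norm_sq.indicator hE).congr (Eventually.of_forall fun s => ?_)
      by_cases hs : s ∈ E <;> simp [hs]
    set z : DirectIntegral 𝓕 := mk ⟨_, hx⟩
    have hz : ∀ᵐ s ∂μ, z s = E.indicator (1 : Ω → ℂ) s • x s :=
      coe_mk (⟨_, hx⟩ : 𝓕.squareIntegrable)
    have e1 : ‖z‖ ^ 2 = ∫ s in E, ‖x s‖ ^ 2 ∂μ := by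
      rw [norm_sq_eq_of_ae_eq hz, ← integral_indicator hE]
      congr 1
      ext s
      by_cases hs : s ∈ E <;> simp [hs]
    have e2 : ‖B z‖ ^ 2 = ∫ s in E, ‖L s (x s)‖ ^ 2 ∂μ := by
      rw [norm_sq_eq_of_ae_eq (hB z), ← integral_indicator hE]
      refine integral_congr_ae ?_
      filter_upwards [hz] with s hs
      rw [hs]
      by_cases hsE : s ∈ E <;> simp [hsE]
    rw [integral_const_mul, ← e1, ← e2, ← mul_pow]
    gcongr
    exact B.le_opNorm z
  filter_upwards [key] with s hs
  refine le_of_sq_le_sq ?_ (by positivity)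
  rwa [mul_pow]

theorem ae_opNorm_le [SigmaFinite μ] (hB : ∀ x : DirectIntegral 𝓕, ∀ᵐ s ∂μ, B x s = L s (x s)) :
    ∀ᵐ s ∂μ, ‖L s‖ ≤ ‖B‖ := by
  obtain ⟨ξ, hξ, hd⟩ := 𝓕.exists_fundamental
  have h : ∀ i, ∀ᵐ s ∂μ, ‖L s (ξ i s)‖ ≤ ‖B‖ * ‖ξ i s‖ := by
    intro i
    obtain ⟨c, hc0, -, hc⟩ := 𝓕.exists_pos_smul_mem_squareIntegrable (hξ i)
    filter_upwards [ae_norm_apply_le_opNorm hB (mk ⟨_, hc⟩),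
      coe_mk (⟨_, hc⟩ : 𝓕.squareIntegrable)] with s h1 h2
    rw [h2, map_smul, norm_smul, norm_smul, Complex.norm_real, Real.norm_of_nonneg (hc0 s).le,
      mul_left_comm] at h1
    exact le_of_mul_le_mul_left h1 (hc0 s)
  filter_upwards [ae_all_iff.2 h] with s hs
  refine (L s).opNorm_le_bound B.opNorm_nonneg fun v => ?_
  exact isClosed_property (p := fun v : H s => ‖L s v‖ ≤ ‖B‖ * ‖v‖) (hd s)
    (isClosed_le (by fun_prop) (by fun_prop)) hs v

end DirectIntegral

end OperatorFields

/-! ### Fields of semigroups and their generators -/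

section SemigroupFields

variable {Ω : Type*} [MeasurableSpace Ω] {μ : Measure Ω}
  {H : Ω → Type*} [∀ s, NormedAddCommGroup (H s)] [∀ s, InnerProductSpace ℂ (H s)]
  {𝓕 : MeasurableHilbertField μ H} {S : ∀ s, ℝ≥0 → H s →L[ℂ] H s}
  {T : ℝ≥0 → DirectIntegral 𝓕 →L[ℂ] DirectIntegral 𝓕} {M ω ν : ℝ}

theorem UniformlyExpBounded.ae_forall (h : UniformlyExpBounded μ S M ω) (hM : 1 ≤ M)
    (hS : ∀ s, IsC0Semigroup (S s)) :
    ∀ᵐ s ∂μ, ∀ t : ℝ≥0, ‖S s t‖ ≤ M * Real.exp (ω * t) := by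
  filter_upwards [h] with s hs t
  rcases eq_or_ne t 0 with rfl | ht
  · rw [(hS s).map_zero]
    exact ContinuousLinearMap.norm_id_le.trans (by simpa using hM)
  · exact hs t (pos_iff_ne_zero.2 ht)

/-- The bound on the fibres holds at a countable dense set of times off one null set, and then at
all times by strong continuity. -/
theorem uniformlyExpBounded_of_norm_le [SigmaFinite μ] (hS : ∀ s, IsC0Semigroup (S s))
    (hTS : ∀ t, ∀ x : DirectIntegral 𝓕, ∀ᵐ s ∂μ, T t x s = S s t (x s))
    (hT : ∀ t : ℝ≥0, ‖T t‖ ≤ M * Real.exp (ω * t)) : UniformlyExpBounded μ S M ω := by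
  have h : ∀ᵐ s ∂μ, ∀ n, ‖S s (TopologicalSpace.denseSeq ℝ≥0 n)‖ ≤
      M * Real.exp (ω * (TopologicalSpace.denseSeq ℝ≥0 n)) := by
    refine ae_all_iff.2 fun n => ?_
    filter_upwards [DirectIntegral.ae_opNorm_le (hTS (TopologicalSpace.denseSeq ℝ≥0 n))]
      with s hs
    exact hs.trans (hT _)
  filter_upwards [h] with s hs t _
  refine (S s t).opNorm_le_bound ((T t).opNorm_nonneg.trans (hT t)) fun v => ?_
  exact isClosed_property (p := fun t : ℝ≥0 => ‖S s t v‖ ≤ M * Real.exp (ω * t) * ‖v‖)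
    (TopologicalSpace.denseRange_denseSeq ℝ≥0)
    (isClosed_le ((hS s).continuous_orbit v).norm (by fun_prop))
    (fun n => (S s _).le_of_opNorm_le (hs n) v) t

theorem norm_le_of_ae_norm_le (hTS : ∀ t, ∀ x : DirectIntegral 𝓕, ∀ᵐ s ∂μ, T t x s = S s t (x s))
    (hM : 0 ≤ M) (hb : ∀ᵐ s ∂μ, ∀ t : ℝ≥0, ‖S s t‖ ≤ M * Real.exp (ω * t)) (t : ℝ≥0) :
    ‖T t‖ ≤ M * Real.exp (ω * t) := by
  have h0 : 0 ≤ M * Real.exp (ω * t) := by positivity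
  refine (T t).opNorm_le_bound h0 fun x => DirectIntegral.norm_le_mul_of_ae_le h0 ?_
  filter_upwards [hTS t x, hb] with s h1 h2
  rw [h1]
  exact (S s t).le_of_opNorm_le (h2 t) _

theorem exp_mul_le_exp_abs_mul {r : ℝ} {t : ℝ≥0} (h : (t : ℝ) ≤ r) :
    Real.exp (ω * t) ≤ Real.exp (|ω| * r) := by
  refine Real.exp_le_exp.2 ?_
  calc ω * t ≤ |ω| * t := mul_le_mul_of_nonneg_right (le_abs_self ω) t.2
    _ ≤ |ω| * r := by gcongr

theorem isC0Semigroup_of_ae_norm_le (hS : ∀ s, IsC0Semigroup (S s))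
    (hTS : ∀ t, ∀ x : DirectIntegral 𝓕, ∀ᵐ s ∂μ, T t x s = S s t (x s))
    (hM : 0 ≤ M) (hb : ∀ᵐ s ∂μ, ∀ t : ℝ≥0, ‖S s t‖ ≤ M * Real.exp (ω * t)) :
    IsC0Semigroup T where
  map_zero := by
    ext x
    refine DirectIntegral.ext_ae ?_
    filter_upwards [hTS 0 x] with s hs
    rw [hs, (hS s).map_zero]
    rfl
  map_add t u := by
    ext x
    refine DirectIntegral.ext_ae ?_
    filter_upwards [hTS (t + u) x, hTS u x, hTS t (T u x)] with s h1 h2 h3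
    rw [h1, (hS s).map_add, ContinuousLinearMap.comp_apply, ContinuousLinearMap.comp_apply, h3, h2]
  continuous_orbit x := by
    refine continuous_iff_continuousAt.2 fun t₀ => ?_
    set C := M * Real.exp (|ω| * (t₀ + 1))
    have hC : ∀ᵐ s ∂μ, ∀ t : ℝ≥0, (t : ℝ) ≤ t₀ + 1 → ‖S s t (x s)‖ ≤ C * ‖x s‖ := by
      filter_upwards [hb] with s hs t ht
      refine (S s t).le_of_opNorm_le ((hs t).trans ?_) _
      exact mul_le_mul_of_nonneg_left (exp_mul_le_exp_abs_mul ht) hM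
    refine DirectIntegral.tendsto_of_dominated (fun t => hTS t x)
      (bound := fun s => 2 * C * ‖x s‖) ?_ ?_ ?_
    · simp only [mul_pow _ ‖_‖]
      exact x.integrable_norm_sq.const_mul _
    · filter_upwards [eventually_le_nhds (lt_add_one t₀)] with t ht
      have ht' : (t : ℝ) ≤ t₀ + 1 := by exact_mod_cast ht
      filter_upwards [hC, hTS t₀ x] with s hs h0
      rw [h0]
      calc ‖S s t (x s) - S s t₀ (x s)‖ ≤ ‖S s t (x s)‖ + ‖S s t₀ (x s)‖ := norm_sub_le _ _
        _ ≤ C * ‖x s‖ + C * ‖x s‖ := add_le_add (hs t ht') (hs t₀ (by linarith))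
        _ = 2 * C * ‖x s‖ := by ring
    · filter_upwards [hTS t₀ x] with s h0
      rw [h0]
      exact ((hS s).continuous_orbit (x s)).tendsto t₀

/-- The Laplace transforms of the fibre semigroups form a bounded measurable field of resolvents of
their generators. -/
theorem exists_isBoundedMeasurableField_resolvent [SigmaFinite μ] [∀ s, CompleteSpace (H s)]
    (hS : ∀ s, IsC0Semigroup (S s))
    (hTS : ∀ t, ∀ x : DirectIntegral 𝓕, ∀ᵐ s ∂μ, T t x s = S s t (x s))
    (hb : ∀ᵐ s ∂μ, ∀ t : ℝ≥0, ‖S s t‖ ≤ M * Real.exp (ω * t)) (hν : ω < ν) :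
    ∃ R : ∀ s, H s →L[ℂ] H s, IsBoundedMeasurableField 𝓕 R ∧
      (∀ x ∈ 𝓕.sections, (fun s => R s (x s)) ∈ 𝓕.sections) ∧
      ∀ᵐ s ∂μ, IsResolventAt (generator (S s)) ν (R s) := by
  have hex : ∀ s, ∃ R : H s →L[ℂ] H s, (∀ t : ℝ≥0, ‖S s t‖ ≤ M * Real.exp (ω * t)) →
      (∀ x, ‖R x‖ ≤ M / (ν - ω) * ‖x‖) ∧
      ∀ x, R x = ∫ t in Set.Ioi (0 : ℝ), Real.exp (-ν * t) • S s t.toNNReal x := by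
    intro s
    by_cases h : ∀ t : ℝ≥0, ‖S s t‖ ≤ M * Real.exp (ω * t)
    · obtain ⟨R, hR⟩ := (hS s).exists_laplace h hν
      exact ⟨R, fun _ => hR⟩
    · exact ⟨0, fun h' => absurd h' h⟩
  choose R hR using hex
  have hmem : ∀ x ∈ 𝓕.sections, (fun s => R s (x s)) ∈ 𝓕.sections := by
    intro x hx
    refine 𝓕.mem_of_aemeasurable_inner _ fun y hy => ?_
    have hm : AEMeasurable (fun s => ∫ t in Set.Ioi (0 : ℝ),
        inner ℂ (y s) (Real.exp (-ν * t) • S s t.toNNReal (x s))) μ := by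
      refine aemeasurable_setIntegral_of_continuous (fun t => ?_) (fun s => ?_) _
      · refine 𝓕.aemeasurable_inner y hy _ ?_
        exact 𝓕.smul_mem (Real.exp (-ν * t) : ℂ) (DirectIntegral.fun_apply_mem (hTS _) hx)
      · exact continuous_const.inner ((hS s).continuous_laplace_integrand ν (x s))
    refine hm.congr ?_
    filter_upwards [hb] with s hs
    rw [(hR s hs).2, integral_inner ((hS s).integrableOn_laplace_integrand hs hν (x s))]
  refine ⟨R, ⟨fun x hx y hy => 𝓕.aemeasurable_inner _ (hmem x hx) y hy, M / (ν - ω), ?_⟩, hmem, ?_⟩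
  · filter_upwards [hb] with s hs
    refine (R s).opNorm_le_bound ?_ (hR s hs).1
    have h0 := (norm_nonneg _).trans (hs 0)
    simp only [NNReal.coe_zero, mul_zero, Real.exp_zero, mul_one] at h0
    exact div_nonneg h0 (sub_pos.2 hν).le
  · filter_upwards [hb] with s hs
    exact (hS s).isResolventAt_laplace hs hν (hR s hs).2

/-- The difference quotients at `x` converge in each fibre and, by the mean value inequality, are
dominated by a multiple of `‖y(s)‖`. -/
theorem mem_graph_generator_of_ae_mem (hS : ∀ s, IsC0Semigroup (S s))
    (hTS : ∀ t, ∀ x : DirectIntegral 𝓕, ∀ᵐ s ∂μ, T t x s = S s t (x s))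
    (hM : 0 ≤ M) (hb : ∀ᵐ s ∂μ, ∀ t : ℝ≥0, ‖S s t‖ ≤ M * Real.exp (ω * t))
    {x y : DirectIntegral 𝓕} (hxy : ∀ᵐ s ∂μ, (x s, y s) ∈ (generator (S s)).graph) :
    (x, y) ∈ (generator T).graph := by
  rw [mem_graph_generator]
  set C := M * Real.exp (|ω| * 1)
  refine DirectIntegral.tendsto_of_dominated
    (f := fun t s => ((t : ℝ) : ℂ)⁻¹ • (S s t (x s) - x s)) (fun t => ?_)
    (bound := fun s => (C + 1) * ‖y s‖) ?_ ?_ ?_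
  · filter_upwards [DirectIntegral.coe_smul ((t : ℝ) : ℂ)⁻¹ (T t x - x),
      DirectIntegral.coe_sub (T t x) x, hTS t x] with s h1 h2 h3
    rw [h1, h2, h3]
  · simp only [mul_pow]
    exact y.integrable_norm_sq.const_mul _
  · filter_upwards [self_mem_nhdsWithin,
      nhdsWithin_le_nhds (eventually_le_nhds (zero_lt_one (α := ℝ≥0)))] with t ht0 ht1
    have ht0' : (0 : ℝ) < t := ht0
    filter_upwards [hxy, hb] with s hs hbs
    have h := (hS s).norm_sub_le_of_mem_graph hs (C := C) (t := t) fun u hu =>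
      (hbs u).trans (mul_le_mul_of_nonneg_left
        (exp_mul_le_exp_abs_mul (by exact_mod_cast hu.trans ht1)) hM)
    refine (norm_sub_le _ _).trans ?_
    rw [norm_smul, norm_inv, Complex.norm_real, Real.norm_of_nonneg ht0'.le, add_mul, one_mul]
    refine add_le_add_left ?_ _
    rwa [inv_mul_le_iff₀ ht0', mul_comm]
  · filter_upwards [hxy] with s hs
    exact (mem_graph_generator _ _ _).1 hs

/-- The direct integral of the fibre generators is contained in the generator of `T`. Both have `ν`
in their resolvent set, and an operator with `ν - A` onto has no proper extension with `ν - B`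
injective. -/
theorem isDirectIntegralOf_generator [SigmaFinite μ] [∀ s, CompleteSpace (H s)]
    (hS : ∀ s, IsC0Semigroup (S s))
    (hTS : ∀ t, ∀ x : DirectIntegral 𝓕, ∀ᵐ s ∂μ, T t x s = S s t (x s))
    (hM : 0 ≤ M) (hb : ∀ᵐ s ∂μ, ∀ t : ℝ≥0, ‖S s t‖ ≤ M * Real.exp (ω * t))
    {A : ∀ s, H s →ₗ.[ℂ] H s} (hA : ∀ s, (A s).IsClosed)
    (hAS : ∀ᵐ s ∂μ, A s = generator (S s)) : IsDirectIntegralOf 𝓕 (generator T) A := by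
  obtain ⟨R, hRb, hRm, hR⟩ :=
    exists_isBoundedMeasurableField_resolvent hS hTS hb (lt_add_one ω)
  have hRA : ∀ᵐ s ∂μ, IsResolventAt (A s) (ω + 1 : ℝ) (R s) := by
    filter_upwards [hR, hAS] with s h1 h2
    rwa [h2]
  have hT := isC0Semigroup_of_ae_norm_le hS hTS hM hb
  have hTb := norm_le_of_ae_norm_le hTS hM hb
  obtain ⟨RT, -, hRT⟩ := hT.exists_laplace hTb (lt_add_one ω)
  have hinj := ((isResolventAt_iff_graph _ _ _).1
    (hT.isResolventAt_laplace hTb (lt_add_one ω) hRT)).2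
  have hle : ∀ x y, (x, y) ∈ (directIntegralOp 𝓕 A).graph → (x, y) ∈ (generator T).graph := by
    intro x y hxy
    refine mem_graph_generator_of_ae_mem hS hTS hM hb ?_
    filter_upwards [(mem_graph_directIntegralOp_iff_ae _ _ _).1 hxy, hAS] with s h1 h2
    rwa [← h2]
  have hsurj : ∀ z : DirectIntegral 𝓕, ∃ x,
      (x, ((ω + 1 : ℝ) : ℂ) • x - z) ∈ (directIntegralOp 𝓕 A).graph := by
    intro z
    obtain ⟨C, hC⟩ := hRb.essBounded
    have hmem : (fun s => R s (z s)) ∈ 𝓕.squareIntegrable := by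
      refine ⟨hRm _ z.coe_mem, ?_⟩
      refine (z.integrable_norm_sq.const_mul (C ^ 2)).mono'
        ((𝓕.aemeasurable_norm (hRm _ z.coe_mem)).pow_const 2).aestronglyMeasurable ?_
      filter_upwards [hC] with s hs
      rw [Real.norm_eq_abs, abs_pow, abs_norm, ← mul_pow]
      gcongr
      exact (R s).le_of_opNorm_le hs _
    refine ⟨DirectIntegral.mk ⟨_, hmem⟩, (mem_graph_directIntegralOp_iff_ae _ _ _).2 ?_⟩
    set x : DirectIntegral 𝓕 := DirectIntegral.mk ⟨_, hmem⟩
    have hx : ∀ᵐ s ∂μ, x s = R s (z s) :=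
      DirectIntegral.coe_mk (⟨_, hmem⟩ : 𝓕.squareIntegrable)
    filter_upwards [hRA, hx, DirectIntegral.coe_sub (((ω + 1 : ℝ) : ℂ) • x) z,
      DirectIntegral.coe_smul ((ω + 1 : ℝ) : ℂ) x] with s h1 h2 h3 h4
    rw [h3, h4, h2]
    exact ((isResolventAt_iff_graph _ _ _).1 h1).1 (z s)
  refine ⟨⟨hA, _, R, hRb, hRA⟩, LinearPMap.eq_of_eq_graph (le_antisymm ?_ ?_)⟩
  · rintro ⟨x, y⟩ hxy
    -- `x'` in the smaller domain has the same image under `ω + 1` minus the operator as `x`.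
    obtain ⟨x', hx'⟩ := hsurj (((ω + 1 : ℝ) : ℂ) • x - y)
    have e := hinj _ _ (hle _ _ hx')
    rw [sub_sub_cancel, hinj _ _ hxy] at e
    rw [← e, sub_sub_cancel] at hx'
    exact hx'
  · rintro ⟨x, y⟩ hxy
    exact hle x y hxy

end SemigroupFields

theorem mainTheorem1
    {Ω : Type*} [TopologicalSpace Ω] [LocallyCompactSpace Ω] [T2Space Ω]
    [MeasurableSpace Ω] [BorelSpace Ω] (μ : Measure Ω) [SigmaFinite μ]
    {H : Ω → Type*} [∀ s, NormedAddCommGroup (H s)] [∀ s, InnerProductSpace ℂ (H s)]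
    [∀ s, CompleteSpace (H s)] (𝓕 : MeasurableHilbertField μ H)
    (S : ∀ s, ℝ≥0 → H s →L[ℂ] H s) (hS : ∀ s, IsC0Semigroup (S s))
    (T : ℝ≥0 → DirectIntegral 𝓕 →L[ℂ] DirectIntegral 𝓕)
    (hT : ∀ t : ℝ≥0, IsDirectIntegralOf 𝓕 (T t).toFullPMap (fun s => (S s t).toFullPMap)) :
    (IsC0Semigroup T ↔ ∃ M ω : ℝ, 1 ≤ M ∧ UniformlyExpBounded μ S M ω) ∧
    (∀ M ω : ℝ, 1 ≤ M → UniformlyExpBounded μ S M ω →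
      (∀ t : ℝ≥0, ‖T t‖ ≤ M * Real.exp (ω * t)) ∧
      ∀ A : ∀ s, H s →ₗ.[ℂ] H s, (∀ s, (A s).IsClosed) →
        (∀ᵐ s ∂μ, A s = generator (S s)) → IsDirectIntegralOf 𝓕 (generator T) A) := by
  have hTS : ∀ t, ∀ x : DirectIntegral 𝓕, ∀ᵐ s ∂μ, T t x s = S s t (x s) :=
    fun t => (hT t).ae_apply
  refine ⟨⟨fun h => ?_, ?_⟩, fun M ω hM hu => ?_⟩
  · obtain ⟨M, ω, hM, hb⟩ := h.exists_exp_bound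
    exact ⟨M, ω, hM, uniformlyExpBounded_of_norm_le hS hTS hb⟩
  · rintro ⟨M, ω, hM, hu⟩
    exact isC0Semigroup_of_ae_norm_le hS hTS (zero_le_one.trans hM) (hu.ae_forall hM hS)
  · have hM0 : 0 ≤ M := zero_le_one.trans hM
    have hb := hu.ae_forall hM hS
    exact ⟨norm_le_of_ae_norm_le hTS hM0 hb,
      fun A hA hAS => isDirectIntegralOf_generator hS hTS hM0 hb hA hAS⟩
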